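/- All rings are commutative with identity. For a ring $A$, let $K$ be its total quotient ring, that is, the localization of $A$ at the set of its non-zero-divisors. An overring of $A$ is a ring $B$ with $A\subseteq B\subseteq K$. The ring $A$ is called perinormal if every overring $B$ of $A$ such that the extension $A\subseteq B$ satisfies going down is flat as an $A$-module. Let $A$ be a reduced Noetherian ring and let $A'$ be the integral closure of $A$ in its total quotient ring. Then $A'$ is perinormal. -/

import Mathlib

/-- An overring of a commutative ring `A` is a ring between `A` and its total quotient ring,
i.e. an `A`-subalgebra of `FractionRing A` (the localization of `A` at its non-zero-divisors).
The ring `A` is perinormal if every overring `B` of `A` such that `A ⊆ B` satisfies going down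
is flat as an `A`-module. -/
def IsPerinormal (A : Type*) [CommRing A] : Prop :=
  ∀ B : Subalgebra A (FractionRing A), Algebra.HasGoingDown A B → Module.Flat A B

/-! Write R for the integral closure. Flatness of an overring B follows once (R : b)B = B for every
b ∈ B. Otherwise a maximal ideal of B contains (R : b), going down produces a prime Q of B over a
minimal prime of (R : b), and `comap_inclusion_notMem_minimalPrimes_denominatorIdeal` forbids this.
R need not be Noetherian, so that lemma works in the ring C of integral elements that some power of
P = Q ∩ A carries into a finite A-algebra D. Locally at P, the prime n = Q ∩ C is finitely generated
(`Subalgebra.exists_fg_ideal_le`). If n is minimal over (C : b), some multiple c of b sends n into C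
locally, hence into n because c ∈ B. The determinant trick makes c integral up to a factor outside
P, so c lies in C locally, against the choice of c. -/

/-! ### Chains of finite length after localizing at a prime -/

open IsLocalRing in
theorem isArtinian_of_maximalIdeal_pow_smul_eq_bot {R M : Type*} [CommRing R] [IsLocalRing R]
    [IsNoetherianRing R] [AddCommGroup M] [Module R M] [Module.Finite R M] (k : ℕ)
    (h : ∀ r ∈ maximalIdeal R ^ k, ∀ x : M, r • x = 0) : IsArtinian R M := by
  rcases subsingleton_or_nontrivial (R ⧸ maximalIdeal R ^ k) with hs | hs
  · have : Subsingleton M := by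
      have h1 : (1 : R) ∈ maximalIdeal R ^ k := by
        rw [Ideal.Quotient.subsingleton_iff.mp hs]; trivial
      exact ⟨fun a b => by rw [← one_smul R a, ← one_smul R b, h 1 h1, h 1 h1]⟩
    infer_instance
  have hloc : IsLocalRing (R ⧸ maximalIdeal R ^ k) :=
    .of_surjective' (Ideal.Quotient.mk _) Ideal.Quotient.mk_surjective
  have hart : IsArtinianRing (R ⧸ maximalIdeal R ^ k) := by
    rw [isArtinianRing_iff_isNilpotent_maximalIdeal]
    refine ⟨k, ?_⟩
    have hle : maximalIdeal (R ⧸ maximalIdeal R ^ k) ≤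
        (maximalIdeal R).map (Ideal.Quotient.mk (maximalIdeal R ^ k)) := fun x hx => by
      obtain ⟨r, rfl⟩ := Ideal.Quotient.mk_surjective x
      exact Ideal.mem_map_of_mem _ fun hr => hx (hr.map _)
    have h1 := Ideal.pow_right_mono hle k
    rw [← Ideal.map_pow, Ideal.map_quotient_self] at h1
    exact le_bot_iff.mp h1
  have ht : Module.IsTorsionBySet R M (maximalIdeal R ^ k : Ideal R) :=
    fun x a => h a.1 a.2 x
  let _ := ht.module
  have : IsScalarTower R (R ⧸ maximalIdeal R ^ k) M := ht.isScalarTower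
  have : Module.Finite (R ⧸ maximalIdeal R ^ k) M := .of_restrictScalars_finite R _ M
  exact isArtinian_of_surjective_algebraMap (S := R) (R := R ⧸ maximalIdeal R ^ k)
    Ideal.Quotient.mk_surjective

section
variable {A M : Type*} [CommRing A] [AddCommGroup M] [Module A M]

theorem Submodule.exists_smul_mem_of_fg (S : Submonoid A) {N N' : Submodule A M} (hN : N.FG)
    (h : ∀ x ∈ N, ∃ s ∈ S, s • x ∈ N') : ∃ s ∈ S, ∀ x ∈ N, s • x ∈ N' := by
  obtain ⟨t, rfl⟩ := hN
  choose! f hf hf' using h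
  refine ⟨∏ x ∈ t, f x, prod_mem fun x hx => hf x (subset_span hx), fun x hx => ?_⟩
  induction hx using span_induction with
  | mem x hx =>
    classical
    rw [← Finset.prod_erase_mul _ _ hx, mul_smul]
    exact N'.smul_mem _ (hf' x (subset_span hx))
  | zero => simp
  | add x y _ _ hx hy => rw [smul_add]; exact add_mem hx hy
  | smul a x _ hx => rw [smul_comm]; exact N'.smul_mem _ hx

theorem Submodule.exists_pow_smul_mem_of_fg (P : Ideal A) {N N' : Submodule A M} (hN : N.FG)
    (h : ∀ x ∈ N, ∃ k : ℕ, ∀ p ∈ P ^ k, p • x ∈ N') : ∃ k : ℕ, P ^ k • N ≤ N' := by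
  obtain ⟨t, rfl⟩ := hN
  choose! f hf using h
  refine ⟨t.sup f, Submodule.smul_le.mpr fun p hp x hx => ?_⟩
  induction hx using span_induction with
  | mem x hx => exact hf x (subset_span hx) p (Ideal.pow_le_pow_right (Finset.le_sup hx) hp)
  | zero => simp
  | add x y _ _ hx hy => rw [smul_add]; exact add_mem hx hy
  | smul a x _ hx => rw [smul_comm]; exact N'.smul_mem _ hx

/-- The localization of M at P is Artinian, so the localized chain stabilizes; s clears
denominators. -/
theorem exists_smul_mem_succ_of_pow_smul_eq_zero [IsNoetherianRing A] [Module.Finite A M]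
    (P : Ideal A) [P.IsPrime] (k : ℕ) (h : ∀ r ∈ P ^ k, ∀ x : M, r • x = 0)
    {J : ℕ → Submodule A M} (hJ : Antitone J) :
    ∃ m, ∀ n ≥ m, ∀ x ∈ J n, ∃ s ∈ P.primeCompl, s • x ∈ J (n + 1) := by
  let R := Localization.AtPrime P
  let MP := LocalizedModule P.primeCompl M
  let f := LocalizedModule.mkLinearMap P.primeCompl M
  have hart : IsArtinian R MP := by
    refine isArtinian_of_maximalIdeal_pow_smul_eq_bot k fun r hr x => ?_
    rw [← Localization.AtPrime.map_eq_maximalIdeal, ← Ideal.map_pow,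
      IsLocalization.mem_map_algebraMap_iff P.primeCompl] at hr
    obtain ⟨⟨⟨a, ha⟩, s⟩, hrs⟩ := hr
    obtain ⟨⟨z, t⟩, rfl⟩ := IsLocalizedModule.mk'_surjective P.primeCompl f x
    have h0 : (algebraMap A R s * r) • IsLocalizedModule.mk' f z t = 0 := by
      rw [mul_comm]
      simp only at hrs
      rw [hrs, algebraMap_smul]
      simp [← IsLocalizedModule.mk'_smul, h a ha z]
    rw [mul_smul] at h0
    exact ((IsLocalization.map_units R s).smul_eq_zero).mp h0
  obtain ⟨m, hm⟩ := IsArtinian.monotone_stabilizes (R := R) (M := MP)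
    ⟨fun n => OrderDual.toDual (Submodule.localized' R P.primeCompl f (J n)), fun a b hab => by
      rintro _ ⟨z, hz, s, rfl⟩
      exact ⟨z, hJ hab hz, s, rfl⟩⟩
  refine ⟨m, fun n hn x hx => ?_⟩
  have he : Submodule.localized' R P.primeCompl f (J n) =
      Submodule.localized' R P.primeCompl f (J (n + 1)) :=
    (hm n hn).symm.trans (hm (n + 1) (by omega))
  have hx' : IsLocalizedModule.mk' f x (1 : P.primeCompl) ∈
      Submodule.localized' R P.primeCompl f (J n) := ⟨x, hx, 1, rfl⟩
  rw [he] at hx'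
  obtain ⟨z, hz, s, hzs⟩ := hx'
  rw [IsLocalizedModule.mk'_eq_mk'_iff] at hzs
  obtain ⟨c, hc⟩ := hzs
  refine ⟨c * s, (c * s).2, ?_⟩
  have : ((c : A) * s) • x = (c : A) • z := by
    simpa [mul_smul, Submonoid.smul_def] using hc
  rw [this]
  exact (J (n + 1)).smul_mem _ hz

theorem exists_smul_mem_succ_of_pow_smul_le [IsNoetherianRing A]
    (P : Ideal A) [P.IsPrime] (k : ℕ) {J : ℕ → Submodule A M} (hJ : Antitone J) (hfg : (J 0).FG)
    (h : ∀ n, P ^ k • J 0 ≤ J n) :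
    ∃ m, ∀ n ≥ m, ∀ x ∈ J n, ∃ s ∈ P.primeCompl, s • x ∈ J (n + 1) := by
  let J0 : Submodule A M := J 0
  have : Module.Finite A J0 := Module.Finite.iff_fg.mpr hfg
  let N : Submodule A J0 := (P ^ k • J0).comap J0.subtype
  have hJ' : Antitone fun n => ((J n).comap J0.subtype).map N.mkQ :=
    fun a b hab => Submodule.map_mono (Submodule.comap_mono (hJ hab))
  obtain ⟨m, hm⟩ := exists_smul_mem_succ_of_pow_smul_eq_zero P k (M := J0 ⧸ N) (by
    intro r hr x
    obtain ⟨x, rfl⟩ := N.mkQ_surjective x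
    rw [← map_smul, Submodule.mkQ_apply, Submodule.Quotient.mk_eq_zero]
    exact Submodule.smul_mem_smul hr x.2) hJ'
  refine ⟨m, fun n hn x hx => ?_⟩
  have hx0 : x ∈ J0 := hJ (Nat.zero_le n) hx
  obtain ⟨s, hs, z, hz, hzs⟩ := hm n hn (N.mkQ ⟨x, hx0⟩) ⟨⟨x, hx0⟩, hx, rfl⟩
  refine ⟨s, hs, ?_⟩
  rw [← map_smul, Submodule.mkQ_apply, Submodule.mkQ_apply, Submodule.Quotient.eq] at hzs
  have h1 : (z : M) - s • x ∈ J (n + 1) := h (n + 1) hzs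
  have h2 : (z : M) ∈ J (n + 1) := hz
  exact (Submodule.sub_mem_iff_right _ h2).mp h1

end

/-! ### Minimal primes and powers of finitely generated ideals -/

theorem Ideal.exists_mul_pow_le {R : Type*} [CommRing R] (S : Submonoid R) {I J : Ideal R}
    (hJ : J.FG) (h : ∀ x ∈ J, ∃ s ∈ S, ∃ k : ℕ, s * x ^ k ∈ I) :
    ∃ k : ℕ, ∃ s ∈ S, ∀ x ∈ J ^ k, s * x ∈ I := by
  let I' : Ideal R :=
    { carrier := {x | ∃ s ∈ S, s * x ∈ I}
      zero_mem' := ⟨1, S.one_mem, by simp⟩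
      add_mem' := by
        rintro a b ⟨s, hs, ha⟩ ⟨t, ht, hb⟩
        refine ⟨s * t, S.mul_mem hs ht, ?_⟩
        have : s * t * (a + b) = t * (s * a) + s * (t * b) := by ring
        rw [this]
        exact I.add_mem (I.mul_mem_left _ ha) (I.mul_mem_left _ hb)
      smul_mem' := by
        rintro c a ⟨s, hs, ha⟩
        refine ⟨s, hs, ?_⟩
        rw [smul_eq_mul, mul_left_comm]
        exact I.mul_mem_left _ ha }
  have hle : J ≤ I'.radical := fun x hx => by
    obtain ⟨s, hs, k, hk⟩ := h x hx
    exact ⟨k, s, hs, hk⟩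
  obtain ⟨k, hk⟩ := Ideal.exists_pow_le_of_le_radical_of_fg hle hJ
  exact ⟨k, Submodule.exists_smul_mem_of_fg S (hJ.pow) fun x hx => hk hx⟩

theorem Ideal.exists_mul_pow_le_of_mem_minimalPrimes {R : Type*} [CommRing R] {I J q : Ideal R}
    (hq : q ∈ I.minimalPrimes) (hJ : J.FG) (hJq : J ≤ q) :
    ∃ k : ℕ, ∃ s ∉ q, ∀ x ∈ J ^ k, s * x ∈ I := by
  have := hq.1.1
  refine Ideal.exists_mul_pow_le q.primeCompl hJ fun x hx => ?_
  have hx' : algebraMap R (Localization.AtPrime q) x ∈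
      (I.map (algebraMap R (Localization.AtPrime q))).radical := by
    rw [IsLocalization.AtPrime.radical_map_of_mem_minimalPrimes _ q I hq]
    exact Ideal.mem_map_of_mem _ (hJq hx)
  obtain ⟨k, hk⟩ := hx'
  rw [← map_pow, IsLocalization.algebraMap_mem_map_algebraMap_iff q.primeCompl] at hk
  obtain ⟨s, hs, hsx⟩ := hk
  exact ⟨s, hs, k, hsx⟩

/-! ### Local finiteness modulo a regular element -/

section
variable {A L : Type*} [CommRing A] [CommRing L] [Algebra A L]

theorem IsUnit.algebraMap_smul_cancel {y : A} (hy : IsUnit (algebraMap A L y)) (n : ℕ) {a b : L}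
    (h : y ^ n • a = y ^ n • b) : a = b := by
  rw [Algebra.smul_def, Algebra.smul_def, map_pow] at h
  exact (hy.pow n).mul_left_cancel h

-- Locally at P this says y^m C ⊆ D + y^(m+1) C, so C/yC is controlled by the finite module D. The
-- chain D ∩ (y^(n+1) C + yD) stabilizes at P, as its first term is carried into yD by a power of P.
open Pointwise in
theorem Subalgebra.exists_pow_smul_smul_eq_add [IsNoetherianRing A] {D C : Subalgebra A L}
    (hD : (Subalgebra.toSubmodule D).FG) (P : Ideal A) [P.IsPrime]
    (hC : ∀ z ∈ C, ∃ k : ℕ, ∀ p ∈ P ^ k, p • z ∈ D) {y : A} (hyP : y ∈ P)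
    (hy : IsUnit (algebraMap A L y)) :
    ∃ m : ℕ, ∀ z ∈ C, ∃ s ∈ P.primeCompl, ∃ d ∈ D, ∃ w ∈ C,
      y ^ m • s • z = d + y ^ (m + 1) • w := by
  let J : ℕ → Submodule A L := fun n =>
    Subalgebra.toSubmodule D ⊓
      (y ^ (n + 1) • Subalgebra.toSubmodule C ⊔ y • Subalgebra.toSubmodule D)
  have hmem : ∀ n x, x ∈ J n ↔ x ∈ D ∧ ∃ w ∈ C, ∃ e ∈ D, x = y ^ (n + 1) • w + y • e := by
    intro n x
    simp only [J, Submodule.mem_inf, Submodule.mem_sup, Submodule.mem_smul_pointwise_iff_exists,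
      Subalgebra.mem_toSubmodule]
    refine and_congr_right fun _ => ⟨?_, ?_⟩
    · rintro ⟨_, ⟨w, hw, rfl⟩, _, ⟨e, he, rfl⟩, rfl⟩
      exact ⟨w, hw, e, he, rfl⟩
    · rintro ⟨w, hw, e, he, rfl⟩
      exact ⟨_, ⟨w, hw, rfl⟩, _, ⟨e, he, rfl⟩, rfl⟩
  have hJ : Antitone J := antitone_nat_of_succ_le fun n x hx => by
    rw [hmem] at hx ⊢
    obtain ⟨hxD, w, hw, e, he, rfl⟩ := hx
    exact ⟨hxD, y • w, C.smul_mem hw _, e, he, by rw [smul_smul, ← pow_succ]⟩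
  have hfg : (J 0).FG := by
    have : IsNoetherian A (Subalgebra.toSubmodule D) := isNoetherian_of_fg_of_noetherian _ hD
    exact Submodule.FG.of_le_of_isNoetherian inf_le_left
  obtain ⟨k, hk⟩ : ∃ k : ℕ, P ^ k • J 0 ≤ y • Subalgebra.toSubmodule D := by
    refine Submodule.exists_pow_smul_mem_of_fg P hfg fun x hx => ?_
    obtain ⟨hxD, w, hw, e, he, rfl⟩ := (hmem _ _).mp hx
    obtain ⟨k, hk⟩ := hC w hw
    refine ⟨k, fun p hp => ?_⟩
    rw [zero_add, pow_one, ← smul_add, smul_comm]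
    refine Submodule.smul_mem_pointwise_smul _ _ _ ?_
    rw [smul_add]
    exact add_mem (hk p hp) (D.smul_mem he p)
  have hyD : y • Subalgebra.toSubmodule D ≤ Subalgebra.toSubmodule D := by
    intro x hx
    obtain ⟨e, he, rfl⟩ := (Submodule.mem_smul_pointwise_iff_exists _ _ _).mp hx
    exact D.smul_mem he y
  obtain ⟨m, hm⟩ := exists_smul_mem_succ_of_pow_smul_le P k hJ hfg fun n =>
    hk.trans (le_inf hyD le_sup_right)
  refine ⟨m + 1, fun z hz => ?_⟩
  -- Here d ∈ D is divisible by a high power of y in C, so it lies in a stable term of the chain.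
  -- Moving it one term further makes the whole relation divisible by y, which is cancelled.
  have descend : ∀ n, ∀ s ∈ P.primeCompl, ∀ d ∈ D, ∀ w ∈ C,
      y ^ (m + 1 + n) • s • z = d + y ^ (m + 1 + n + 1) • w →
      ∃ s ∈ P.primeCompl, ∃ d ∈ D, ∃ w ∈ C,
        y ^ (m + 1) • s • z = d + y ^ (m + 1 + 1) • w := by
    intro n
    induction n with
    | zero => exact fun s hs d hd w hw h => ⟨s, hs, d, hd, w, hw, h⟩
    | succ n ih =>
      intro s hs d hd w hw h
      have hdJ : d ∈ J (m + (n + 1)) := by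
        refine (hmem _ _).mpr ⟨hd, s • z - y • w, sub_mem (C.smul_mem hz _) (C.smul_mem hw _),
          0, zero_mem _, ?_⟩
        rw [eq_sub_of_add_eq h.symm]
        simp only [Algebra.smul_def, map_mul, map_pow, pow_succ, pow_add]
        ring
      obtain ⟨t, ht, htd⟩ := hm _ (by omega) d hdJ
      obtain ⟨-, w', hw', e, he, hde⟩ := (hmem _ _).mp htd
      refine ih (t * s) (mul_mem ht hs) e he (w' + t • w) (add_mem hw' (C.smul_mem hw t)) ?_
      apply hy.algebraMap_smul_cancel 1
      have h2 := congrArg (t • ·) h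
      simp only [smul_add, hde] at h2
      simp only [Algebra.smul_def, map_mul, map_pow, map_one, pow_succ, pow_zero, pow_add] at h2 ⊢
      linear_combination h2
  obtain ⟨k, hk⟩ := hC z hz
  refine descend k 1 (one_mem _) (y ^ (m + 1 + k) • z)
    (hk _ (Ideal.pow_le_pow_right (by omega) (Ideal.pow_mem_pow hyP _))) 0 (zero_mem _) (by simp)

/-- The ideal of elements of `C` that multiply `b` into `C`. -/
def Subalgebra.denominatorIdeal (C : Subalgebra A L) (b : L) : Ideal C where
  carrier := {r | (r : L) * b ∈ C}
  zero_mem' := by simp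
  add_mem' := by
    intro r s hr hs
    simp only [Set.mem_ofPred_eq, Subalgebra.coe_add, add_mul] at *
    exact add_mem hr hs
  smul_mem' := by
    intro c r hr
    simp only [Set.mem_ofPred_eq, smul_eq_mul, Subalgebra.coe_mul, mul_assoc] at *
    exact mul_mem c.2 hr

theorem Subalgebra.mem_denominatorIdeal {C : Subalgebra A L} {b : L} {r : C} :
    r ∈ C.denominatorIdeal b ↔ (r : L) * b ∈ C := Iff.rfl

/-- The integral elements that some power of `P` multiplies into `D`. -/
def Subalgebra.integralTransform (D : Subalgebra A L) (P : Ideal A) : Subalgebra A L where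
  carrier := {z | IsIntegral A z ∧ ∃ k : ℕ, ∀ p ∈ P ^ k, p • z ∈ D}
  algebraMap_mem' a := ⟨isIntegral_algebraMap, 0, fun p _ => D.smul_mem (D.algebraMap_mem a) p⟩
  add_mem' := by
    rintro z w ⟨hz, k, hk⟩ ⟨hw, l, hl⟩
    refine ⟨hz.add hw, k + l, fun p hp => ?_⟩
    rw [smul_add]
    exact add_mem (hk p (Ideal.pow_le_pow_right (by omega) hp))
      (hl p (Ideal.pow_le_pow_right (by omega) hp))
  mul_mem' := by
    rintro z w ⟨hz, k, hk⟩ ⟨hw, l, hl⟩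
    refine ⟨hz.mul hw, k + l, fun p hp => ?_⟩
    rw [pow_add] at hp
    induction hp using Submodule.mul_induction_on' with
    | mem_mul_mem p hp q hq =>
      rw [← smul_mul_smul_comm]
      exact mul_mem (hk p hp) (hl q hq)
    | add p _ q _ h1 h2 => rw [add_smul]; exact add_mem h1 h2

/-- Cayley–Hamilton for multiplication by x on N; the unit y in N replaces faithfulness. -/
theorem isIntegral_of_forall_mul_mem_of_isUnit {N : Submodule A L} (hN : N.FG) {x y : L}
    (hyN : y ∈ N) (hy : IsUnit y) (h : ∀ g ∈ N, x * g ∈ N) : IsIntegral A x := by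
  have : Module.Finite A N := Module.Finite.iff_fg.mpr hN
  let φ : N →ₗ[A] N := (LinearMap.mulLeft A x).restrict (p := N) (q := N) h
  have hφ : ∀ g : N, (φ g : L) = x * g := fun _ => rfl
  obtain ⟨p, hp, hpx⟩ := LinearMap.exists_monic_and_aeval_eq_zero A φ
  refine ⟨p, hp, ?_⟩
  have hpow : ∀ (n : ℕ) (g : N), ((φ ^ n) g : L) = x ^ n * g := by
    intro n g
    induction n with
    | zero => simp
    | succ n ih => rw [pow_succ', Module.End.mul_apply, hφ, ih, pow_succ', mul_assoc]
  have key : ∀ (q : Polynomial A) (g : N),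
      (Polynomial.aeval φ q g : L) = Polynomial.aeval x q * g := by
    intro q g
    induction q using Polynomial.induction_on' with
    | add p q hp hq => simp [hp, hq, add_mul]
    | monomial n a => simp [Polynomial.aeval_monomial, hpow, Algebra.smul_def, mul_assoc]
  have := key p ⟨y, hyN⟩
  rw [hpx] at this
  exact (hy.mul_left_eq_zero).mp this.symm

end

/-! ### Primes of C and elements of B -/

section
variable {A L : Type*} [CommRing A] [CommRing L] [Algebra A L]

/-- Generators are y together with lifts to n of generators of G = D ∩ (y^m n + y^(m+1) C), which is
finite over A as a submodule of D. -/
theorem Subalgebra.exists_fg_ideal_le [IsNoetherianRing A] {D C : Subalgebra A L}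
    (hD : (Subalgebra.toSubmodule D).FG) (P : Ideal A) [P.IsPrime]
    (hC : ∀ z ∈ C, ∃ k : ℕ, ∀ p ∈ P ^ k, p • z ∈ D) {y : A} (hyP : y ∈ P)
    (hy : IsUnit (algebraMap A L y)) (n : Ideal C) (hyn : algebraMap A C y ∈ n) :
    ∃ n₀ : Ideal C, n₀.FG ∧ n₀ ≤ n ∧ algebraMap A C y ∈ n₀ ∧
      ∀ z ∈ n, ∃ s ∈ P.primeCompl, s • z ∈ n₀ := by
  obtain ⟨m, hm⟩ := Subalgebra.exists_pow_smul_smul_eq_add hD P hC hyP hy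
  let G : Submodule A L :=
    { carrier := {d | d ∈ D ∧ ∃ z ∈ n, ∃ w : C, y ^ m • (z : L) = d + y ^ (m + 1) • (w : L)}
      zero_mem' := ⟨zero_mem _, 0, zero_mem _, 0, by simp⟩
      add_mem' := by
        rintro d e ⟨hd, z, hz, w, h⟩ ⟨he, z', hz', w', h'⟩
        refine ⟨add_mem hd he, z + z', add_mem hz hz', w + w', ?_⟩
        simp only [Subalgebra.coe_add, smul_add, h, h']
        abel
      smul_mem' := by
        rintro a d ⟨hd, z, hz, w, h⟩
        refine ⟨D.smul_mem hd a, a • z, ?_, a • w, ?_⟩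
        · rw [Algebra.smul_def]
          exact n.mul_mem_left _ hz
        · rw [Subalgebra.coe_smul, smul_comm, h, smul_add, smul_comm a, Subalgebra.coe_smul] }
  have hG : G.FG := by
    have : IsNoetherian A (Subalgebra.toSubmodule D) := isNoetherian_of_fg_of_noetherian _ hD
    exact Submodule.FG.of_le_of_isNoetherian
      (show G ≤ Subalgebra.toSubmodule D from fun d hd => hd.1)
  obtain ⟨t, ht⟩ := hG
  have hGt : ∀ d ∈ t, ∃ z ∈ n, ∃ w : C, y ^ m • (z : L) = d + y ^ (m + 1) • (w : L) :=
    fun d hd => (show d ∈ G from ht ▸ Submodule.subset_span hd).2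
  choose! f hf g hg using hGt
  have hyn₀ : algebraMap A C y ∈ Ideal.span (insert (algebraMap A C y) (f '' t)) :=
    Ideal.subset_span (Set.mem_insert _ _)
  refine ⟨Ideal.span (insert (algebraMap A C y) (f '' t)),
    Submodule.fg_span ((t.finite_toSet.image f).insert _), ?_, hyn₀, fun z hz => ?_⟩
  · rw [Ideal.span_le]
    rintro _ (rfl | ⟨d, hd, rfl⟩)
    · exact hyn
    · exact hf d hd
  have lift : ∀ d ∈ G, ∃ z₀ ∈ Ideal.span (insert (algebraMap A C y) (f '' t)), ∃ w : C,
      y ^ m • (z₀ : L) = d + y ^ (m + 1) • (w : L) := by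
    intro d hd
    rw [← ht] at hd
    induction hd using Submodule.span_induction with
    | mem d hd =>
      exact ⟨f d, Ideal.subset_span (Set.mem_insert_of_mem _ ⟨d, hd, rfl⟩), g d, hg d hd⟩
    | zero => exact ⟨0, zero_mem _, 0, by simp⟩
    | add d e _ _ hd he =>
      obtain ⟨z, hz, w, h⟩ := hd
      obtain ⟨z', hz', w', h'⟩ := he
      refine ⟨z + z', add_mem hz hz', w + w', ?_⟩
      simp only [Subalgebra.coe_add, smul_add, h, h']
      abel
    | smul a d _ hd =>
      obtain ⟨z, hz, w, h⟩ := hd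
      refine ⟨a • z, ?_, a • w, ?_⟩
      · rw [Algebra.smul_def]
        exact Ideal.mul_mem_left _ _ hz
      · rw [Subalgebra.coe_smul, smul_comm, h, smul_add, smul_comm a, Subalgebra.coe_smul]
  obtain ⟨s, hs, d, hd, w, hw, h⟩ := hm z z.2
  have hszn : s • z ∈ n := by
    rw [Algebra.smul_def]
    exact n.mul_mem_left _ hz
  obtain ⟨z₀, hz₀, w₀, h₀⟩ := lift d ⟨hd, s • z, hszn, ⟨w, hw⟩, by simpa using h⟩
  refine ⟨s, hs, ?_⟩
  have : s • z = z₀ + algebraMap A C y * (⟨w, hw⟩ - w₀) := by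
    apply Subtype.ext
    apply hy.algebraMap_smul_cancel m
    rw [Subalgebra.coe_smul, h]
    simp only [Subalgebra.coe_add, Subalgebra.coe_mul, Subalgebra.coe_sub,
      Subalgebra.coe_algebraMap, Algebra.smul_def, map_mul, map_pow, pow_succ] at h₀ ⊢
    linear_combination -h₀
  rw [this]
  exact add_mem hz₀ (Ideal.mul_mem_right _ _ hyn₀)

theorem exists_isIntegral_mul_notMem_of_pow_smul_mem [IsNoetherianRing A] {B : Subalgebra A L}
    (hB : integralClosure A L ≤ B) (Q : Ideal B) [Q.IsPrime] {b : L} (hb : b ∈ B)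
    {D : Subalgebra A L} (hDint : D ≤ integralClosure A L) (hD : (Subalgebra.toSubmodule D).FG)
    {N : ℕ} (hN : ∀ p ∈ Q.comap (algebraMap A B) ^ N, p • b ∈ D) {y : A}
    (hyQ : algebraMap A B y ∈ Q) (hy : IsUnit (algebraMap A L y)) :
    ∃ r, ∃ hr : IsIntegral A r, IsIntegral A (r * b) ∧ (⟨r, hB hr⟩ : B) ∉ Q := by
  by_contra! hI
  set P := Q.comap (algebraMap A B) with hP
  have hPprime : P.IsPrime := Ideal.comap_isPrime _ _
  let C := D.integralTransform P
  have hCR : C ≤ integralClosure A L := fun z hz => hz.1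
  have hDC : D ≤ C := fun z hz => ⟨hDint hz, 0, fun p _ => D.smul_mem hz p⟩
  let n : Ideal C := Q.comap (Subalgebra.inclusion (hCR.trans hB))
  have hn : n.IsPrime := Ideal.comap_isPrime _ _
  have hnP : ∀ a : A, algebraMap A C a ∈ n ↔ a ∈ P := fun a => Iff.rfl
  have hCint : Algebra.IsIntegral A C := ⟨fun z =>
    (isIntegral_algHom_iff C.val Subtype.val_injective).mp z.2.1⟩
  let I := C.denominatorIdeal b
  have hIn : I ≤ n := fun r hr => hI r r.2.1 (hCR hr)
  have hmin : n ∈ I.minimalPrimes := by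
    -- I contains the image of P^N, so any prime between I and n also lies over P; incomparability
    -- for integral extensions forces equality.
    refine ⟨⟨hn, hIn⟩, fun p' ⟨hp', hIp'⟩ hle x hx => ?_⟩
    by_contra hx'
    refine (Ideal.comap_lt_comap_of_integral_mem_sdiff (R := A) hle ⟨hx, hx'⟩
      (Algebra.IsIntegral.isIntegral x)).not_ge fun p hp => ?_
    refine hp'.mem_of_pow_mem N (hIp' ?_)
    rw [← map_pow]
    change algebraMap A L (p ^ N) * b ∈ C
    rw [← Algebra.smul_def]
    exact hDC (hN _ (Ideal.pow_mem_pow hp N))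
  obtain ⟨n₀, hn₀fg, hn₀n, hyn₀, hn₀⟩ :=
    Subalgebra.exists_fg_ideal_le hD P (C := C) (fun z hz => hz.2) hyQ hy n hyQ
  have hex := Ideal.exists_mul_pow_le_of_mem_minimalPrimes hmin hn₀fg hn₀n
  classical
  obtain ⟨s, hs, hsI⟩ := Nat.find_spec hex
  have hj := Nat.find_min hex (m := Nat.find hex - 1)
  obtain ⟨j, hk⟩ : ∃ j, Nat.find hex = j + 1 := by
    refine Nat.exists_eq_succ_of_ne_zero fun h0 => hs (hIn ?_)
    rw [h0] at hsI
    simpa using hsI 1 (by simp)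
  rw [hk] at hj hsI
  specialize hj (by omega)
  push Not at hj
  -- Otherwise one multiplier outside n would serve all of n₀ ^ j, against the minimality of j + 1.
  obtain ⟨d, hd, hdn⟩ : ∃ d ∈ n₀ ^ j, ∀ r, r * (s * d) ∈ I → r ∈ n := by
    by_contra! hcon
    obtain ⟨r, hr, hrs⟩ := Submodule.exists_smul_mem_of_fg n.primeCompl
      (N := n₀ ^ j) (N' := Submodule.comap (LinearMap.mulLeft C s) I) (hn₀fg.pow) (by
        intro d hd
        obtain ⟨r, hr, hrn⟩ := hcon d hd
        refine ⟨r, hrn, ?_⟩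
        simpa [mul_left_comm] using hr)
    obtain ⟨x, hx, hxI⟩ := hj (r * s) (n.primeCompl.mul_mem hr hs)
    refine hxI ?_
    have := hrs x hx
    simpa [mul_left_comm, mul_assoc] using this
  set c : L := (s * d : C) * b with hc
  have hcB : c ∈ B := mul_mem (hB (hCR (s * d).2)) hb
  have hnc : ∀ g ∈ n₀, ∃ h : (g : L) * c ∈ C, (⟨g * c, h⟩ : C) ∈ n := by
    intro g hg
    have h : (g : L) * c ∈ C := by
      have := hsI (d * g) (by rw [pow_succ]; exact Ideal.mul_mem_mul hd hg)
      rw [Subalgebra.mem_denominatorIdeal] at this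
      convert this using 1
      simp only [hc, Subalgebra.coe_mul]
      ring
    refine ⟨h, ?_⟩
    -- The essential use of c ∈ B: Q absorbs multiplication by c.
    exact Q.mul_mem_right ⟨c, hcB⟩ (hn₀n hg)
  let N₀ : Submodule C L := Submodule.map (Algebra.linearMap C L) n₀
  have hN₀ : N₀.FG := Submodule.FG.map _ hn₀fg
  obtain ⟨s', hs', hs'c⟩ := Submodule.exists_smul_mem_of_fg
    (P.primeCompl.map (algebraMap A C)) (N := n₀)
    (N' := N₀.comap ((LinearMap.mulRight C c).comp (Algebra.linearMap C L))) hn₀fg (by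
      intro g hg
      obtain ⟨h, hgn⟩ := hnc g hg
      obtain ⟨t, ht, htn⟩ := hn₀ _ hgn
      refine ⟨_, ⟨t, ht, rfl⟩, ⟨_, htn, ?_⟩⟩
      simp [Algebra.smul_def, mul_assoc])
  obtain ⟨s', hs', rfl⟩ := hs'
  have hint : IsIntegral C (s' • c) := by
    refine isIntegral_of_forall_mul_mem_of_isUnit hN₀ (y := algebraMap A L y)
      ⟨_, hyn₀, rfl⟩ hy ?_
    rintro _ ⟨g, hg, rfl⟩
    obtain ⟨g', hg', h⟩ := hs'c g hg
    refine ⟨g', hg', h.trans ?_⟩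
    simp [Algebra.smul_def, mul_left_comm, mul_comm]
  have hint' : IsIntegral A (s' • c) := isIntegral_trans _ hint
  obtain ⟨u, hu, huP⟩ := Submodule.exists_smul_mem_of_fg P.primeCompl (N := P)
    (N' := (Submodule.restrictScalars A n₀).comap (Algebra.linearMap A C))
    (IsNoetherian.noetherian P) (fun p hp => by
      obtain ⟨t, ht, htn⟩ := hn₀ _ ((hnP p).mpr hp)
      exact ⟨t, ht, by simpa [Algebra.smul_def] using htn⟩)
  have hPc : ∀ p ∈ P, p • (u • s' • c) ∈ C := by
    intro p hp
    have h1 : algebraMap A C (u * p) ∈ n₀ := huP p hp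
    obtain ⟨h, -⟩ := hnc _ h1
    have h2 := C.smul_mem h s'
    convert h2 using 1
    simp only [Algebra.smul_def, Subalgebra.coe_algebraMap, map_mul, Subalgebra.coe_mul]
    ring
  have hmemC : u • s' • c ∈ C := by
    refine ⟨hint'.smul u, ?_⟩
    obtain ⟨k, hk⟩ := Submodule.exists_pow_smul_mem_of_fg P (N := P)
      (N' := (Subalgebra.toSubmodule D).comap (LinearMap.toSpanSingleton A L (u • s' • c)))
      (IsNoetherian.noetherian P) fun p hp => by
        obtain ⟨k, hk⟩ := (hPc p hp).2
        refine ⟨k, fun q hq => ?_⟩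
        simpa [mul_smul] using hk q hq
    refine ⟨k + 1, fun p hp => ?_⟩
    rw [pow_succ] at hp
    exact hk hp
  have hus : algebraMap A C (u * s') ∈ n := by
    refine hdn _ ?_
    rw [Subalgebra.mem_denominatorIdeal]
    convert hmemC using 1
    simp only [hc, Subalgebra.coe_mul, Subalgebra.coe_algebraMap, map_mul, Algebra.smul_def]
    ring
  rw [hnP] at hus
  exact P.primeCompl.mul_mem hu hs' hus

end

/-! ### Minimal primes of denominator ideals, and flatness -/

section
variable {A L : Type*} [CommRing A] [CommRing L] [Algebra A L]

theorem comap_inclusion_notMem_minimalPrimes_denominatorIdeal [IsNoetherianRing A]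
    {B : Subalgebra A L} (hB : integralClosure A L ≤ B) (Q : Ideal B) [Q.IsPrime] {b : L}
    (hb : b ∈ B) {y : A} (hy : IsUnit (algebraMap A L y)) (hyb : IsIntegral A (y • b)) :
    Q.comap (Subalgebra.inclusion hB) ∉
      ((integralClosure A L).denominatorIdeal b).minimalPrimes := by
  intro hmin
  set P := Q.comap (algebraMap A B) with hP
  have hyQ : algebraMap A B y ∈ Q := by
    refine hmin.1.2 (x := algebraMap A (integralClosure A L) y) ?_
    rw [Subalgebra.mem_denominatorIdeal, Subalgebra.coe_algebraMap, ← Algebra.smul_def]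
    exact hyb
  have hPfg : P.FG := IsNoetherian.noetherian P
  obtain ⟨k, s, hs, hsP⟩ := Ideal.exists_mul_pow_le_of_mem_minimalPrimes hmin
    (J := P.map (algebraMap A (integralClosure A L))) (hPfg.map _)
    (Ideal.map_le_iff_le_comap.mpr fun p hp => hp)
  have hsP' : ∀ p ∈ P ^ k, IsIntegral A (p • (s * b)) := by
    intro p hp
    have h := hsP (algebraMap A _ p) (by rw [← Ideal.map_pow]; exact Ideal.mem_map_of_mem _ hp)
    rw [Subalgebra.mem_denominatorIdeal] at h
    change IsIntegral A _ at h
    convert h using 1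
    simp only [Algebra.smul_def, Subalgebra.coe_mul, Subalgebra.coe_algebraMap]
    ring
  obtain ⟨t, ht⟩ : (P ^ k).FG := IsNoetherian.noetherian _
  -- D is generated by s and by generators of P^k times sb, so that P^k carries sb into D.
  let S : Set L := insert (s : L) ((fun p : A => p • (s * b : L)) '' t)
  have hSfin : S.Finite := (t.finite_toSet.image _).insert _
  have hSint : ∀ x ∈ S, IsIntegral A x := by
    rintro _ (rfl | ⟨p, hp, rfl⟩)
    · exact s.2
    · exact hsP' p (ht ▸ Submodule.subset_span hp)
  have hsD : (s : L) ∈ Algebra.adjoin A S := Algebra.subset_adjoin (Set.mem_insert _ _)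
  obtain ⟨r, hr, hrb, hrQ⟩ := exists_isIntegral_mul_notMem_of_pow_smul_mem hB Q
    (b := s * b) (mul_mem (hB s.2) hb) (D := Algebra.adjoin A S)
    (Algebra.adjoin_le hSint) (fg_adjoin_of_finite hSfin hSint) (N := k) (by
      intro p hp
      rw [← hP, ← ht] at hp
      induction hp using Submodule.span_induction with
      | mem p hp => exact Algebra.subset_adjoin (Set.mem_insert_of_mem _ ⟨p, hp, rfl⟩)
      | zero => simp
      | add p q _ _ hp hq => rw [add_smul]; exact add_mem hp hq
      | smul a p _ hp => rw [smul_assoc]; exact Subalgebra.smul_mem _ hp a) hyQ hy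
  have h : (⟨r, hr⟩ : integralClosure A L) * s ∈ Q.comap (Subalgebra.inclusion hB) := by
    refine hmin.1.2 ?_
    rw [Subalgebra.mem_denominatorIdeal, Subalgebra.coe_mul, mul_assoc]
    exact hrb
  exact (hmin.1.1.mem_or_mem h).elim hrQ hs

/-- Equational criterion: write 1 = ∑ c_j v_j with each v_j a common denominator of all x_i; the
elements v_j x_i of A trivialize the relation. -/
theorem Module.Flat.of_forall_map_comap_toSpanSingleton_eq_top
    (hinj : Function.Injective (algebraMap A L)) (B : Subalgebra A L)
    (h : ∀ b : B, Ideal.map (algebraMap A B)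
      ((Subalgebra.toSubmodule (⊥ : Subalgebra A L)).comap
        (LinearMap.toSpanSingleton A L (b : L))) = ⊤) :
    Module.Flat A B := by
  refine Module.Flat.of_forall_isTrivialRelation fun {l f x} hfx => ?_
  let I : Fin l → Ideal A := fun i => (Subalgebra.toSubmodule (⊥ : Subalgebra A L)).comap
    (LinearMap.toSpanSingleton A L (x i : L))
  have hJ : Ideal.map (algebraMap A B) (∏ i, I i) = ⊤ := by
    rw [← Ideal.mapHom_apply, map_prod, ← Ideal.one_eq_top]
    exact Finset.prod_eq_one fun i _ => (h (x i)).trans Ideal.one_eq_top.symm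
  have h1 : (1 : B) ∈ Ideal.map (algebraMap A B) (∏ i, I i) := hJ ▸ Submodule.mem_top
  obtain ⟨k, c, u, hcu⟩ := (Submodule.mem_span_set').mp h1
  choose v hv hvu using fun j => (u j).2
  have hmem : ∀ i j, ∃ a : A, algebraMap A L a = v j • (x i : L) := fun i j => by
    have hvi : v j ∈ I i := (Ideal.prod_le_inf.trans (Finset.inf_le (Finset.mem_univ i))) (hv j)
    exact Algebra.mem_bot.mp hvi
  choose a ha using hmem
  refine ⟨k, a, c, fun i => ?_, fun j => hinj ?_⟩
  · apply Subtype.ext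
    have h2 := congrArg (fun z : B => ((x i * z : B) : L)) hcu
    simp only [← hvu, smul_eq_mul, mul_one, Finset.mul_sum] at h2
    rw [← h2]
    simp only [AddSubmonoidClass.coe_finsetSum, Algebra.smul_def, ha,
      Subalgebra.coe_mul, Subalgebra.coe_algebraMap]
    refine Finset.sum_congr rfl fun j _ => ?_
    ring
  · have h2 := congrArg (fun z : B => v j • (z : L)) hfx
    simp only [AddSubmonoidClass.coe_finsetSum, Subalgebra.coe_smul, Subalgebra.coe_zero,
      smul_zero, Finset.smul_sum] at h2
    rw [map_sum, map_zero, ← h2]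
    refine Finset.sum_congr rfl fun i _ => ?_
    rw [map_mul, ha, smul_comm, Algebra.smul_def (f i)]

end

/-! ### Passage to the total quotient ring and conclusion -/

theorem isFractionRing_integralClosure (A K : Type*) [CommRing A] [CommRing K] [Algebra A K]
    [IsFractionRing A K] : IsFractionRing (integralClosure A K) K := by
  refine ⟨fun r => ?_, fun z => ?_, fun h => ⟨1, by simpa using Subtype.ext h⟩⟩
  · obtain ⟨⟨a, s⟩, has⟩ := IsLocalization.surj (nonZeroDivisors A) (r.1 : K)
    have ha : a ∈ nonZeroDivisors A := by
      rw [mem_nonZeroDivisors_iff_right]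
      intro a' ha'
      have h1 : algebraMap A (integralClosure A K) (a' * s) * r = 0 := by
        apply Subtype.ext
        have := congrArg (algebraMap A K) ha'
        simp only [map_mul, map_zero] at this has
        rw [← has] at this
        simp only [Subalgebra.coe_mul, Subalgebra.coe_algebraMap, map_mul, Subalgebra.coe_zero]
        linear_combination this
      have h2 := (mem_nonZeroDivisors_iff_right.mp r.2) _ h1
      have h3 : a' * s = 0 := IsFractionRing.injective A K (by
        simpa using congrArg Subtype.val h2)
      exact (mem_nonZeroDivisors_iff_right.mp s.2) _ h3
    have hu := IsLocalization.map_units K (⟨a, ha⟩ : nonZeroDivisors A)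
    rw [← has] at hu
    exact isUnit_of_mul_isUnit_left hu
  · obtain ⟨⟨a, s⟩, has⟩ := IsLocalization.surj (nonZeroDivisors A) z
    refine ⟨⟨algebraMap A _ a, ⟨algebraMap A _ s, ?_⟩⟩, has⟩
    rw [mem_nonZeroDivisors_iff_right]
    intro x hx
    apply Subtype.ext
    have := congrArg Subtype.val hx
    exact ((IsLocalization.map_units K s).mul_left_eq_zero).mp this

theorem corollary27 (A : Type*) [CommRing A] [IsReduced A] [IsNoetherianRing A]
    (K : Type*) [CommRing K] [Algebra A K] [IsFractionRing A K] :
    IsPerinormal (integralClosure A K) := by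
  have := isFractionRing_integralClosure A K
  set R := integralClosure A K
  intro B hGD
  let L := FractionRing R
  let e : L ≃ₐ[R] K := FractionRing.algEquiv R K
  have hsurj : ∀ x : L, IsIntegral A x → ∃ r : R, algebraMap R L r = x := fun x hx => by
    have hx' : IsIntegral A (e x) := hx.map (e.toAlgHom.restrictScalars A)
    exact ⟨⟨e x, hx'⟩, e.injective (e.commutes _)⟩
  have hRint : ∀ r : R, IsIntegral A (algebraMap R L r) := fun r =>
    ((isIntegral_algHom_iff R.val Subtype.val_injective).mp r.2).algebraMap
  have hBint : integralClosure A L ≤ B.restrictScalars A := fun x hx => by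
    obtain ⟨r, rfl⟩ := hsurj x hx
    exact B.algebraMap_mem r
  refine Module.Flat.of_forall_map_comap_toSpanSingleton_eq_top
    (IsFractionRing.injective R L) B fun b => ?_
  by_contra hne
  obtain ⟨Q, hQ, hbQ⟩ := Ideal.exists_le_maximal _ hne
  obtain ⟨q, hq, hqQ⟩ := Ideal.exists_minimalPrimes_le (Ideal.map_le_iff_le_comap.mp hbQ)
  have := hq.1.1
  have hover : Q.LiesOver (Q.comap (algebraMap R B)) := ⟨rfl⟩
  obtain ⟨Q', -, hQ', hQ'q⟩ := Ideal.exists_ideal_le_liesOver_of_le (p := q) Q hqQ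
  obtain ⟨⟨x, y⟩, hxy⟩ := IsLocalization.surj (nonZeroDivisors A) (e b)
  have hey : e (algebraMap A L y) = algebraMap A K y :=
    (e.toAlgHom.restrictScalars A).commutes y
  have hy : IsUnit (algebraMap A L y) := by
    rw [← MulEquiv.isUnit_map e.toMulEquiv]
    exact hey ▸ IsLocalization.map_units K y
  have hyb : (y : A) • (b : L) = algebraMap A L x := by
    apply e.injective
    rw [Algebra.smul_def, map_mul, hey, mul_comm, hxy]
    exact ((e.toAlgHom.restrictScalars A).commutes x).symm
  -- R and the integral closure of A in L are identified through φ, so that (R : b) becomes a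
  -- denominator ideal.
  let φ : R →+* integralClosure A L := (algebraMap R L).codRestrict _ hRint
  have hφ : Function.Surjective φ := fun x => by
    obtain ⟨r, hr⟩ := hsurj x x.2
    exact ⟨r, Subtype.ext hr⟩
  have hI : (Subalgebra.toSubmodule (⊥ : Subalgebra R L)).comap
      (LinearMap.toSpanSingleton R L (b : L)) =
      ((integralClosure A L).denominatorIdeal (b : L)).comap φ := by
    ext r
    change r • (b : L) ∈ (⊥ : Subalgebra R L) ↔ IsIntegral A (algebraMap R L r * b)
    rw [Algebra.mem_bot, Algebra.smul_def]
    refine ⟨?_, fun h => hsurj _ h⟩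
    rintro ⟨c, hc⟩
    exact hc ▸ hRint c
  rw [hI, Ideal.comap_minimalPrimes_eq_of_surjective hφ] at hq
  obtain ⟨q', hq', rfl⟩ := hq
  have hQ'' : (show Ideal (B.restrictScalars A) from Q').IsPrime := hQ'
  refine comap_inclusion_notMem_minimalPrimes_denominatorIdeal hBint
    (show Ideal (B.restrictScalars A) from Q') (b := b) b.2 hy
    (hyb ▸ isIntegral_algebraMap) ?_
  convert hq' using 1
  apply Ideal.comap_injective_of_surjective φ hφ
  rw [hQ'q.over]
  rfl
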